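/- Let $\alpha$ be a set (for instance the positive integers) and let $\mathfrak{M}$ be the class of all matroids whose ground set is a finite subset of $\alpha$. For a non-empty loopless matroid $\mathsf{M}$ let $\mathcal{L}(\mathsf{M})$ be its lattice of flats, and let $\Delta$ be the order complex of its proper part: the faces of $\Delta$ are the chains (including the empty chain) of flats containing neither the bottom nor the top element of $\mathcal{L}(\mathsf{M})$. The chain polynomial of $\mathsf{M}$ is the $f$-polynomial $$f_{\Delta}(t)=\sum_{i=0}^{d} f_i\,t^{d-i}\in\mathbb{Z}[t],$$ where $f_i$ is the number of faces of $\Delta$ of size $i$ and $d$ is the largest size of a face. **Theorem.** The map $f:\mathfrak{M}\to\mathbb{Z}[t]$ assigning to each non-empty loopless matroid its chain polynomial, and to each matroid that has loops or is empty the zero polynomial, is a valuative invariant. That is: 1. (Invariant) $f(\mathsf{M})=f(\mathsf{N})$ whenever $\mathsf{M},\mathsf{N}\in\mathfrak{M}$ are isomorphic, possibly on different ground sets. 2. (Valuation) For every finite $E\subseteq\alpha$, write $\mathscr{P}(\mathsf{M})\subseteq\mathbb{R}^E$ for the base polytope of a matroid $\mathsf{M}$ on $E$, i.e. the convex hull of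 the indicator vectors of its bases, and let $\mathbb{I}_E$ be the group of functions $\mathbb{R}^E\to\mathbb{Z}$ generated by the indicator functions $1_{\mathscr{P}(\mathsf{M})}$ of the base polytopes of all matroids $\mathsf{M}$ on $E$. Then there is a homomorphism of abelian groups $\widehat f:\mathbb{I}_E\to\mathbb{Z}[t]$ with $f(\mathsf{M})=\widehat f(1_{\mathscr{P}(\mathsf{M})})$ for every matroid $\mathsf{M}$ on $E$. -/

import Mathlib

open Polynomial

namespace ChainPoly

/-! ### Order complexes and `f`-polynomials -/

/-- The faces of the order complex of the proper part of a poset `P`: the finite chains of `P`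
(the empty chain included) that contain neither the bottom nor the top element of `P`. -/
def orderComplex (P : Type*) [PartialOrder P] : Set (Finset P) :=
  {C | IsChain (· ≤ ·) (C : Set P) ∧ ∀ x ∈ C, ¬ IsBot x ∧ ¬ IsTop x}

/-- The number `f_i` of faces of size `i` of a simplicial complex, given by its set of faces. -/
noncomputable def fVector {V : Type*} (Δ : Set (Finset V)) (i : ℕ) : ℕ :=
  {C : Finset V | C ∈ Δ ∧ C.card = i}.ncard

/-- The size `d` of the largest face of a simplicial complex. -/
noncomputable def maxFaceSize {V : Type*} (Δ : Set (Finset V)) : ℕ :=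
  sSup (Finset.card '' Δ)

/-- The `f`-polynomial `∑ i = 0, …, d, f_i x ^ (d - i)` of a simplicial complex. -/
noncomputable def fPolynomial {V : Type*} (Δ : Set (Finset V)) : ℤ[X] :=
  ∑ i ∈ Finset.range (maxFaceSize Δ + 1), C (fVector Δ i : ℤ) * X ^ (maxFaceSize Δ - i)

/-! ### Matroids -/

/-- The matroids whose ground set is a finite subset of `α`. -/
def FinMatroid (α : Type*) := {M : Matroid α // M.Finite}

/-- The flats of a matroid, ordered by inclusion. -/
abbrev Flats {α : Type*} (M : Matroid α) := {F : Set α // M.IsFlat F}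

open Classical in
/-- The map sending a non-empty loopless matroid to its chain polynomial, that is, to the
`f`-polynomial of the order complex of the proper part of its lattice of flats, and sending a
matroid with loops, or the empty matroid, to zero. -/
noncomputable def chainPolynomial {α : Type*} (M : FinMatroid α) : ℤ[X] :=
  if M.1.Loopless ∧ M.1.E.Nonempty then fPolynomial (orderComplex (Flats M.1)) else 0

/-- Two matroids, on possibly different ground sets, are isomorphic if some bijection between
their ground sets identifies their bases. -/
def Isomorphic {α β : Type*} (M : Matroid α) (N : Matroid β) : Prop :=
  ∃ e : M.E ≃ N.E, ∀ B : Set M.E,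
    M.IsBase (Subtype.val '' B) ↔ N.IsBase (Subtype.val '' (e '' B))

/-! ### Valuations -/

/-- The base polytope in `ℝ ^ E` of a matroid `M` with ground set `E`: the convex hull of the
indicator vectors of the bases. -/
def basePolytope {α : Type*} (E : Finset α) (M : Matroid α) : Set (E → ℝ) :=
  convexHull ℝ {x | ∃ B : Set α, M.IsBase B ∧ x = fun i : E => B.indicator (fun _ => (1 : ℝ)) (i : α)}

/-- The family of the base polytopes of all matroids with ground set `E`. -/
def basePolytopes {α : Type*} (E : Finset α) : Set (Set (E → ℝ)) :=
  {P | ∃ M : Matroid α, M.E = (E : Set α) ∧ P = basePolytope E M}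

/-- The integer-valued indicator function of a set. -/
noncomputable def indicatorFun {V : Type*} (P : Set V) : V → ℤ :=
  P.indicator (fun _ => 1)

/-- The indicator subgroup of a family of sets: the group of all integer combinations of the
indicator functions of its members. -/
def indicatorSubgroup {V : Type*} (𝔓 : Set (Set V)) : AddSubgroup (V → ℤ) :=
  AddSubgroup.closure (indicatorFun '' 𝔓)

/-- A map `f` on a family `𝔓` of polytopes is a (strong) valuation if it factors through
`P ↦ indicatorFun P` by a homomorphism from the indicator subgroup. -/
def IsStrongValuation {V A : Type*} [AddCommGroup A] (𝔓 : Set (Set V)) (f : 𝔓 → A) : Prop :=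
  ∃ g : indicatorSubgroup 𝔓 →+ A, ∀ P : 𝔓,
    f P = g ⟨indicatorFun P.1, AddSubgroup.subset_closure (Set.mem_image_of_mem _ P.2)⟩

/-- A map on matroids is a valuation if, for every finite ground set `E`, its restriction to the
matroids with ground set `E`, seen as a map on their base polytopes, is a valuation. -/
def IsValuation {α A : Type*} [AddCommGroup A] (f : FinMatroid α → A) : Prop :=
  ∀ E : Finset α, ∃ F : basePolytopes E → A, IsStrongValuation (basePolytopes E) F ∧
    ∀ (M : FinMatroid α) (hM : M.1.E = (E : Set α)),
      F ⟨basePolytope E M.1, M.1, hM, rfl⟩ = f M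

/-- A map on matroids is an invariant if it takes the same value on isomorphic matroids. -/
def IsInvariant {α A : Type*} (f : FinMatroid α → A) : Prop :=
  ∀ M N : FinMatroid α, Isomorphic M.1 N.1 → f M = f N

/-- A valuative invariant is a map on matroids that is both an invariant and a valuation. -/
def IsValuativeInvariant {α A : Type*} [AddCommGroup A] (f : FinMatroid α → A) : Prop :=
  IsInvariant f ∧ IsValuation f

end ChainPoly

namespace ChainPoly

open Set Filter Topology

/-! ### Euler characteristic and maxima of functionals on compact convex sets -/

section Euler

variable {ι : Type*}

/-! For valuativity it suffices that every integer relation between indicator functions of base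
polytopes on `E` also holds between the chain polynomials (`isStrongValuation_of_relations`). The
coefficients for a loopless matroid count the chains of nonempty proper subsets of `E` made of
flats. Fix such a chain and weight each element by the number of members containing it. The bases of
maximal weight cover `E` exactly when the matroid is loopless and all members are flats
(`forall_mem_isMaxWeightBase_iff`).

Covering `E` respects relations: inclusion-exclusion reduces it to whether the maximal bases avoid a
set `A`, which the maximum of one perturbed weight detects. Maxima of linear functionals respect
relations because the Euler characteristic of compact convex sets, `1` if nonempty and `0`
otherwise, does (`sum_nonempty_eq_zero`). The exponents depend on the rank, but a relation splits by
rank, since polytopes of different ranks lie in disjoint parallel hyperplanes.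

Invariance holds because an isomorphism induces an order isomorphism of lattices of flats. -/

theorem sum_mul_isGreatest_eq_zero (s : Finset ι) (a : ι → ℤ) (K : ι → Set ℝ)
    (hcl : ∀ i ∈ s, IsClosed (K i)) (hconv : ∀ i ∈ s, Convex ℝ (K i))
    (h : ∀ t, ∑ i ∈ s, a i * indicatorFun (K i) t = 0) (m : ℝ) :
    ∑ i ∈ s, a i * indicatorFun {t | IsGreatest (K i) t} m = 0 := by
  -- The indicator of a closed interval drops just to the right of `m` exactly when `m` is its
  -- maximum. One `t > m` close enough to `m` serves all of `s`.
  have key : ∀ i ∈ s, ∀ᶠ t in 𝓝[>] m, indicatorFun (K i) t =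
      indicatorFun (K i) m - indicatorFun {t | IsGreatest (K i) t} m := by
    intro i hi
    by_cases hm : m ∈ K i
    · by_cases hg : IsGreatest (K i) m
      · filter_upwards [self_mem_nhdsWithin] with t ht
        have : t ∉ K i := fun h' => absurd (hg.2 h') (not_le.2 ht)
        simp [indicatorFun, hm, hg, this]
      · obtain ⟨y, hy, hmy⟩ : ∃ y ∈ K i, m < y := by
          by_contra! hcon
          exact hg ⟨hm, hcon⟩
        filter_upwards [Ioo_mem_nhdsGT hmy] with t ht
        have : t ∈ K i := (hconv i hi).ordConnected.out hm hy ⟨ht.1.le, ht.2.le⟩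
        simp [indicatorFun, hm, hg, this]
    · have hg : ¬ IsGreatest (K i) m := fun h' => hm h'.1
      filter_upwards [nhdsWithin_le_nhds ((hcl i hi).isOpen_compl.mem_nhds hm)] with t ht
      simp [indicatorFun, hm, hg, notMem_of_mem_compl ht]
  obtain ⟨t, ht⟩ := ((Filter.eventually_all_finset s).2 key).exists
  have e1 : ∑ i ∈ s, a i * indicatorFun {t | IsGreatest (K i) t} m =
      ∑ i ∈ s, a i * indicatorFun (K i) m - ∑ i ∈ s, a i * indicatorFun (K i) t := by
    rw [← Finset.sum_sub_distrib]
    refine Finset.sum_congr rfl fun i hi => ?_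
    rw [ht i hi]; ring
  rw [e1, h, h, sub_zero]

open Classical in
-- A compact set has one greatest element if nonempty and none otherwise, so its Euler
-- characteristic is a sum over the finitely many candidate maxima.
theorem sum_nonempty_eq_zero_real (s : Finset ι) (a : ι → ℤ) (K : ι → Set ℝ)
    (hc : ∀ i ∈ s, IsCompact (K i)) (hconv : ∀ i ∈ s, Convex ℝ (K i))
    (h : ∀ t, ∑ i ∈ s, a i * indicatorFun (K i) t = 0) :
    ∑ i ∈ s, a i * (if (K i).Nonempty then 1 else 0) = 0 := by
  have key : ∀ i ∈ s, (if (K i).Nonempty then (1 : ℤ) else 0) =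
      ∑ m ∈ s.image fun i => sSup (K i), indicatorFun {t | IsGreatest (K i) t} m := by
    intro i hi
    split_ifs with hne
    · have hg := (hc i hi).isGreatest_sSup hne
      rw [Finset.sum_eq_single_of_mem _ (Finset.mem_image_of_mem _ hi)]
      · simp [indicatorFun, hg]
      · intro b _ hb
        have : ¬ IsGreatest (K i) b := fun hb' => hb (hb'.unique hg)
        simp [indicatorFun, this]
    · refine (Finset.sum_eq_zero fun m _ => ?_).symm
      have : ¬ IsGreatest (K i) m := fun hb' => hne ⟨_, hb'.1⟩
      simp [indicatorFun, this]
  rw [Finset.sum_congr rfl fun i hi => by rw [key i hi, Finset.mul_sum], Finset.sum_comm]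
  exact Finset.sum_eq_zero fun m _ =>
    sum_mul_isGreatest_eq_zero s a K (fun i hi => (hc i hi).isClosed) hconv h m

open Classical in
/-- The Euler characteristic of compact convex sets respects linear relations between their
indicator functions. -/
theorem sum_nonempty_eq_zero {J : Type*} [Fintype J] (s : Finset ι) (a : ι → ℤ)
    (P : ι → Set (J → ℝ)) (hc : ∀ i ∈ s, IsCompact (P i)) (hconv : ∀ i ∈ s, Convex ℝ (P i))
    (h : ∀ x, ∑ i ∈ s, a i * indicatorFun (P i) x = 0) :
    ∑ i ∈ s, a i * (if (P i).Nonempty then 1 else 0) = 0 := by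
  -- Induction on the set `T` of free coordinates. For `T = ∅` the slice tests membership of `y`.
  -- Freeing `j₀` applies the real case to projections onto that coordinate, whose fibres are slices
  -- with `T` free.
  have key : ∀ (T : Finset J) (y : J → ℝ),
      ∑ i ∈ s, a i * (if (P i ∩ {x | ∀ j ∉ T, x j = y j}).Nonempty then 1 else 0) = 0 := by
    intro T
    induction T using Finset.induction_on with
    | empty =>
      intro y
      refine (Finset.sum_congr rfl fun i _ => ?_).trans (h y)
      have : {x : J → ℝ | ∀ j ∉ (∅ : Finset J), x j = y j} = {y} := by
        ext x; simp [funext_iff]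
      rw [this, inter_singleton_nonempty, indicatorFun, Set.indicator_apply]
    | insert j₀ T hj ih =>
      intro y
      set Q : ι → Set (J → ℝ) := fun i => P i ∩ {x | ∀ j ∉ insert j₀ T, x j = y j} with hQ
      have hset : {x : J → ℝ | ∀ j ∉ insert j₀ T, x j = y j} =
          ⋂ j ∉ insert j₀ T, (LinearMap.proj (R := ℝ) (φ := fun _ : J => ℝ) j) ⁻¹' {y j} := by
        ext x; simp
      have hcl : IsClosed {x : J → ℝ | ∀ j ∉ insert j₀ T, x j = y j} := by
        rw [hset]
        exact isClosed_biInter fun j _ => isClosed_singleton.preimage (continuous_apply j)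
      have hcv : Convex ℝ {x : J → ℝ | ∀ j ∉ insert j₀ T, x j = y j} := by
        rw [hset]
        exact convex_iInter₂ fun j _ => (convex_singleton _).linear_preimage _
      have := sum_nonempty_eq_zero_real s a (fun i => (fun x : J → ℝ => x j₀) '' Q i)
        (fun i hi => ((hc i hi).inter_right hcl).image (continuous_apply j₀))
        (fun i hi => ((hconv i hi).inter hcv).linear_image (LinearMap.proj (R := ℝ) j₀))
        (by
          intro t
          rw [← ih (Function.update y j₀ t)]
          refine Finset.sum_congr rfl fun i _ => ?_
          congr 1
          rw [indicatorFun, Set.indicator_apply]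
          refine if_congr ?_ rfl rfl
          constructor
          · rintro ⟨x, ⟨hx, hx'⟩, rfl⟩
            refine ⟨x, hx, fun j hjT => ?_⟩
            rcases eq_or_ne j j₀ with rfl | hne
            · simp
            · rw [Function.update_of_ne hne]
              exact hx' j (by simp [hne, hjT])
          · rintro ⟨x, hx, hx'⟩
            refine ⟨x, ⟨hx, fun j hjT => ?_⟩, ?_⟩
            · rw [Finset.mem_insert, not_or] at hjT
              rw [hx' j hjT.2, Function.update_of_ne hjT.1]
            · simpa using hx' j₀ hj)
      simpa only [image_nonempty] using this
  simpa using key Finset.univ 0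

/-- The maximum of a linear functional over compact convex sets respects linear relations between
their indicator functions. -/
theorem sum_isGreatest_image_eq_zero {J : Type*} [Fintype J] (s : Finset ι) (a : ι → ℤ)
    (P : ι → Set (J → ℝ)) (hc : ∀ i ∈ s, IsCompact (P i)) (hconv : ∀ i ∈ s, Convex ℝ (P i))
    (h : ∀ x, ∑ i ∈ s, a i * indicatorFun (P i) x = 0) (φ : (J → ℝ) →ₗ[ℝ] ℝ) (m : ℝ) :
    ∑ i ∈ s, a i * indicatorFun {t | IsGreatest (φ '' P i) t} m = 0 := by
  classical
  have hφ : Continuous φ := φ.continuous_of_finiteDimensional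
  refine sum_mul_isGreatest_eq_zero s a (fun i => φ '' P i)
    (fun i hi => ((hc i hi).image hφ).isClosed) (fun i hi => (hconv i hi).linear_image φ)
    (fun t => ?_) m
  -- `t` lies in `φ '' P i` exactly when the slice of `P i` at level `t` is nonempty.
  rw [← sum_nonempty_eq_zero s a (fun i => P i ∩ φ ⁻¹' {t})
    (fun i hi => (hc i hi).inter_right (isClosed_singleton.preimage hφ))
    (fun i hi => (hconv i hi).inter ((convex_singleton _).linear_preimage _)) fun x => ?_]
  · refine Finset.sum_congr rfl fun i _ => ?_
    rw [indicatorFun, Set.indicator_apply]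
    rfl
  · by_cases hx : φ x = t
    · rw [← h x]
      exact Finset.sum_congr rfl fun i _ => by simp [indicatorFun, Set.indicator_apply, hx]
    · exact Finset.sum_eq_zero fun i _ => by simp [indicatorFun, hx]

end Euler

/-! ### Maximal base weights as maxima over the base polytope -/

section Weight

variable {α : Type*}

/-- The total weight of the elements of `E` that lie in `B`. -/
noncomputable def setWeight (E : Finset α) (w : α → ℕ) (B : Set α) : ℕ :=
  ∑ e ∈ E, B.indicator w e

/-- The set of weights of the bases of a matroid. -/
def baseWeights (E : Finset α) (w : α → ℕ) (M : Matroid α) : Set ℕ :=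
  setWeight E w '' {B | M.IsBase B}

/-- The linear functional on `ℝ ^ E` that computes the weight of an indicator vector. -/
noncomputable def weightFunctional (E : Finset α) (w : α → ℕ) : (E → ℝ) →ₗ[ℝ] ℝ :=
  ∑ e : E, (w e : ℝ) • LinearMap.proj e

theorem weightFunctional_indicator (E : Finset α) (w : α → ℕ) (B : Set α) :
    weightFunctional E w (fun i : E => B.indicator (fun _ => (1 : ℝ)) (i : α)) =
      setWeight E w B := by
  classical
  simp only [weightFunctional, setWeight, LinearMap.sum_apply, LinearMap.smul_apply,
    LinearMap.proj_apply, Nat.cast_sum, smul_eq_mul, ← Finset.sum_coe_sort E]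
  exact Finset.sum_congr rfl fun e _ => by by_cases he : (e : α) ∈ B <;> simp [he]

/-- The indicator vectors spanning the base polytope are finitely many. -/
theorem finite_baseVectors (E : Finset α) (M : Matroid α) :
    {x : E → ℝ | ∃ B : Set α, M.IsBase B ∧
      x = fun i : E => B.indicator (fun _ => (1 : ℝ)) (i : α)}.Finite := by
  refine (Set.Finite.pi' fun _ : E => ({0, 1} : Set ℝ).toFinite).subset ?_
  rintro x ⟨B, -, rfl⟩ i
  by_cases hi : (i : α) ∈ B <;> simp [hi]

theorem isCompact_basePolytope (E : Finset α) (M : Matroid α) : IsCompact (basePolytope E M) :=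
  Set.Finite.isCompact_convexHull (𝕜 := ℝ) (finite_baseVectors E M)

theorem isGreatest_image_basePolytope (E : Finset α) (w : α → ℕ) (M : Matroid α) (m : ℕ) :
    IsGreatest (weightFunctional E w '' basePolytope E M) m ↔
      IsGreatest (baseWeights E w M) m := by
  have himg : weightFunctional E w '' basePolytope E M =
      convexHull ℝ ((fun n : ℕ => (n : ℝ)) '' baseWeights E w M) := by
    rw [basePolytope, LinearMap.image_convexHull]
    congr 1
    ext t
    simp only [mem_image, baseWeights, mem_ofPred_eq]
    constructor
    · rintro ⟨_, ⟨B, hB, rfl⟩, rfl⟩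
      exact ⟨_, ⟨B, hB, rfl⟩, (weightFunctional_indicator E w B).symm⟩
    · rintro ⟨_, ⟨B, hB, rfl⟩, rfl⟩
      exact ⟨_, ⟨B, hB, rfl⟩, weightFunctional_indicator E w B⟩
  rw [himg]
  constructor
  · rintro ⟨hm, hub⟩
    have hub' : ∀ n ∈ baseWeights E w M, n ≤ m := fun n hn => by
      exact_mod_cast hub (subset_convexHull ℝ _ (mem_image_of_mem _ hn))
    refine ⟨?_, hub'⟩
    by_contra hcon
    -- A maximum of the hull must be a generator: otherwise all generators, hence the hull, lie
    -- strictly below it.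
    have : convexHull ℝ ((fun n : ℕ => (n : ℝ)) '' baseWeights E w M) ⊆ Iio (m : ℝ) := by
      refine convexHull_min ?_ (convex_Iio _)
      rintro _ ⟨n, hn, rfl⟩
      have hlt : n < m := lt_of_le_of_ne (hub' n hn) (by rintro rfl; exact hcon hn)
      exact Nat.cast_lt (α := ℝ).2 hlt
    exact lt_irrefl (m : ℝ) (this hm)
  · rintro ⟨hm, hub⟩
    refine ⟨subset_convexHull ℝ _ (mem_image_of_mem _ hm), ?_⟩
    refine convexHull_min (t := Iic (m : ℝ)) ?_ (convex_Iic _)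
    rintro _ ⟨n, hn, rfl⟩
    simpa using hub hn

/-- The maximal weight of a base respects linear relations between base polytopes. -/
theorem sum_isGreatest_baseWeights_eq_zero {ι : Type*} (E : Finset α) (s : Finset ι) (a : ι → ℤ)
    (M : ι → Matroid α) (h : ∀ x, ∑ i ∈ s, a i * indicatorFun (basePolytope E (M i)) x = 0)
    (w : α → ℕ) (m : ℕ) :
    ∑ i ∈ s, a i * indicatorFun {n | IsGreatest (baseWeights E w (M i)) n} m = 0 := by
  rw [← sum_isGreatest_image_eq_zero s a (fun i => basePolytope E (M i))
    (fun i _ => isCompact_basePolytope E _) (fun i _ => convex_convexHull ℝ _) h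
    (weightFunctional E w) m]
  refine Finset.sum_congr rfl fun i _ => ?_
  have := isGreatest_image_basePolytope E w (M i) m
  by_cases hg : IsGreatest (baseWeights E w (M i)) m
  · simp [indicatorFun, hg, this.2 hg]
  · simp [indicatorFun, hg, mt this.1 hg]

end Weight

/-! ### Elements covered by bases of maximal weight -/

section MaxWeight

variable {α : Type*}

/-- A base of maximal weight. -/
def IsMaxWeightBase (E : Finset α) (w : α → ℕ) (M : Matroid α) (B : Set α) : Prop :=
  M.IsBase B ∧ ∀ B', M.IsBase B' → setWeight E w B' ≤ setWeight E w B

theorem setWeight_le (E : Finset α) (w : α → ℕ) (B : Set α) : setWeight E w B ≤ ∑ e ∈ E, w e :=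
  Finset.sum_le_sum fun e _ => Set.indicator_le_self' (fun _ _ => Nat.zero_le _) e

theorem exists_isMaxWeightBase (E : Finset α) (w : α → ℕ) (M : Matroid α) :
    ∃ B, IsMaxWeightBase E w M B := by
  obtain ⟨B₀, hB₀⟩ := M.exists_isBase
  have hbdd : BddAbove (baseWeights E w M) := by
    refine ⟨∑ e ∈ E, w e, ?_⟩
    rintro _ ⟨B, -, rfl⟩
    exact setWeight_le E w B
  obtain ⟨B, hB, hBw⟩ := Nat.sSup_mem (s := baseWeights E w M) ⟨_, B₀, hB₀, rfl⟩ hbdd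
  exact ⟨B, hB, fun B' hB' => hBw ▸ le_csSup hbdd ⟨B', hB', rfl⟩⟩

open Classical in
/-- A large multiple of the weight `w`, perturbed by the indicator function of `A`. -/
noncomputable def perturbedWeight (E : Finset α) (w : α → ℕ) (A : Finset α) (e : α) : ℕ :=
  (E.card + 1) * w e + if e ∈ A then 1 else 0

open Classical in
theorem setWeight_perturbedWeight {E A : Finset α} (hA : A ⊆ E) (w : α → ℕ) (B : Set α) :
    setWeight E (perturbedWeight E w A) B =
      (E.card + 1) * setWeight E w B + (A.filter (· ∈ B)).card := by
  have : (A.filter (· ∈ B)).card = ∑ e ∈ E, B.indicator (fun e => if e ∈ A then 1 else 0) e := by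
    rw [Finset.card_filter, ← Finset.sum_subset hA]
    · exact Finset.sum_congr rfl fun e he => by simp [Set.indicator_apply, he]
    · intro e _ he
      simp [Set.indicator_apply, he]
  rw [this, setWeight, setWeight, Finset.mul_sum, ← Finset.sum_add_distrib]
  refine Finset.sum_congr rfl fun e _ => ?_
  by_cases he : e ∈ B <;> simp [he, perturbedWeight]

/-- As `|A ∩ B| < |E| + 1`, the perturbed weight orders bases lexicographically by `w`, then by `|A
∩ B|`. Its maximum modulo `|E| + 1` is the largest `|A ∩ B|` over `w`-maximal bases. -/
theorem disjoint_isMaxWeightBase_iff {E A : Finset α} (hA : A ⊆ E) (w : α → ℕ) (M : Matroid α) :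
    (∀ B, IsMaxWeightBase E w M B → ∀ e ∈ A, e ∉ B) ↔
      ∃ m, IsGreatest (baseWeights E (perturbedWeight E w A) M) ((E.card + 1) * m) := by
  classical
  have hlt : ∀ B : Set α, (A.filter (· ∈ B)).card < E.card + 1 := fun B =>
    Nat.lt_succ_of_le ((Finset.card_filter_le _ _).trans (Finset.card_le_card hA))
  have hzero : ∀ B : Set α, (A.filter (· ∈ B)).card = 0 ↔ ∀ e ∈ A, e ∉ B := fun B => by
    rw [Finset.card_eq_zero, Finset.filter_eq_empty_iff]
  constructor
  · intro h
    obtain ⟨B, hB⟩ := exists_isMaxWeightBase E w M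
    refine ⟨setWeight E w B, ⟨B, hB.1, ?_⟩, ?_⟩
    · rw [setWeight_perturbedWeight hA, (hzero B).2 (h B hB), add_zero]
    · rintro _ ⟨B', hB', rfl⟩
      rw [setWeight_perturbedWeight hA]
      rcases (hB.2 B' hB').eq_or_lt with heq | hlt'
      · have hmax : IsMaxWeightBase E w M B' := ⟨hB', fun B'' h'' => heq ▸ hB.2 B'' h''⟩
        rw [(hzero B').2 (h B' hmax), heq, add_zero]
      · calc (E.card + 1) * setWeight E w B' + (A.filter (· ∈ B')).card
            ≤ (E.card + 1) * setWeight E w B' + (E.card + 1) := by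
              gcongr; exact (hlt B').le
          _ = (E.card + 1) * (setWeight E w B' + 1) := by ring
          _ ≤ _ := by gcongr; exact hlt'
  · rintro ⟨m, ⟨B, hB, hBm⟩, hub⟩ B' hB'
    rw [← hzero]
    rw [setWeight_perturbedWeight hA] at hBm
    have hB0 : (A.filter (· ∈ B)).card = 0 := by
      have := congrArg (· % (E.card + 1)) hBm
      simpa [Nat.add_mod, Nat.mod_eq_of_lt (hlt B)] using this
    have hBw : setWeight E w B = m := by
      rw [hB0, add_zero] at hBm
      exact Nat.eq_of_mul_eq_mul_left (Nat.succ_pos _) hBm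
    have h1 := hub ⟨B', hB'.1, rfl⟩
    rw [setWeight_perturbedWeight hA] at h1
    have h2 := Nat.mul_le_mul_left (E.card + 1) (hB'.2 B hB)
    rw [hBw] at h2
    omega

open Classical in
/-- Whether each element lies in a base of maximal weight respects linear relations between base
polytopes. -/
theorem sum_forall_mem_isMaxWeightBase_eq_zero {ι : Type*} (E : Finset α) (s : Finset ι)
    (a : ι → ℤ) (M : ι → Matroid α)
    (h : ∀ x, ∑ i ∈ s, a i * indicatorFun (basePolytope E (M i)) x = 0) (w : α → ℕ) :
    ∑ i ∈ s, a i *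
      (if ∀ e ∈ E, ∃ B, IsMaxWeightBase E w (M i) B ∧ e ∈ B then 1 else 0) = 0 := by
  -- A maximum is unique and bounded by the total weight, so the existential over `m` becomes a
  -- finite sum of indicators.
  have hgreat : ∀ A ∈ E.powerset, ∀ i,
      (if ∀ B, IsMaxWeightBase E w (M i) B → ∀ e ∈ A, e ∉ B then (1 : ℤ) else 0) =
      ∑ m ∈ Finset.range (∑ e ∈ E, perturbedWeight E w A e + 1),
        indicatorFun {n | IsGreatest (baseWeights E (perturbedWeight E w A) (M i)) n}
          ((E.card + 1) * m) := by
    intro A hA i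
    rw [if_congr (disjoint_isMaxWeightBase_iff (Finset.mem_powerset.1 hA) w (M i)) rfl rfl]
    split_ifs with hm
    · obtain ⟨m, hm⟩ := hm
      rw [Finset.sum_eq_single m]
      · simp [indicatorFun, hm]
      · intro b _ hb
        have : ¬ IsGreatest (baseWeights E (perturbedWeight E w A) (M i)) ((E.card + 1) * b) :=
          fun hb' => hb (Nat.eq_of_mul_eq_mul_left (Nat.succ_pos _) (hb'.unique hm))
        simp [indicatorFun, this]
      · intro hm'
        refine absurd ?_ hm'
        obtain ⟨B, -, hB⟩ := hm.1
        have h1 := setWeight_le E (perturbedWeight E w A) B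
        rw [hB] at h1
        rw [Finset.mem_range]
        nlinarith [Nat.zero_le (E.card * m)]
    · refine (Finset.sum_eq_zero fun m _ => ?_).symm
      have : ¬ IsGreatest (baseWeights E (perturbedWeight E w A) (M i)) ((E.card + 1) * m) :=
        fun hb' => hm ⟨m, hb'⟩
      simp [indicatorFun, this]
  -- The sets `A` avoided by all maximal bases are the subsets of the uncovered set `L`; their
  -- alternating sum is `1` if `L` is empty and `0` otherwise.
  have hexcl : ∀ i, (if ∀ e ∈ E, ∃ B, IsMaxWeightBase E w (M i) B ∧ e ∈ B then (1 : ℤ) else 0) =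
      ∑ A ∈ E.powerset, (-1) ^ A.card *
        (if ∀ B, IsMaxWeightBase E w (M i) B → ∀ e ∈ A, e ∉ B then 1 else 0) := by
    intro i
    set L := E.filter fun e => ∀ B, IsMaxWeightBase E w (M i) B → e ∉ B with hL
    have hpow : L.powerset = E.powerset.filter fun A =>
        ∀ B, IsMaxWeightBase E w (M i) B → ∀ e ∈ A, e ∉ B := by
      ext A
      simp only [Finset.mem_powerset, Finset.mem_filter, hL, Finset.subset_iff]
      exact ⟨fun hA => ⟨fun e he => (hA he).1, fun B hB e he => (hA he).2 B hB⟩,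
        fun hA e he => ⟨hA.1 he, fun B hB => hA.2 B hB e he⟩⟩
    have := Finset.sum_powerset_neg_one_pow_card (x := L)
    rw [hpow, Finset.sum_filter] at this
    simp only [mul_ite, mul_one, mul_zero]
    rw [this]
    refine if_congr ?_ rfl rfl
    rw [hL, Finset.filter_eq_empty_iff]
    push Not
    rfl
  simp_rw [hexcl, Finset.mul_sum]
  rw [Finset.sum_comm]
  refine Finset.sum_eq_zero fun A hA => ?_
  rw [Finset.sum_congr rfl fun i _ => by
    rw [hgreat A hA i, Finset.mul_sum, Finset.mul_sum], Finset.sum_comm]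
  refine Finset.sum_eq_zero fun m _ => ?_
  have := sum_isGreatest_baseWeights_eq_zero E s a M h (perturbedWeight E w A) ((E.card + 1) * m)
  rw [← mul_zero ((-1 : ℤ) ^ A.card), ← this, Finset.mul_sum]
  exact Finset.sum_congr rfl fun i _ => by ring

end MaxWeight

/-! ### Chains of flats through the bases of maximal chain weight -/

section Chain

variable {α : Type*}

/-- Along a chain of sets one can choose compatible bases, extending a given independent set if its
elements are independent of the members of the chain that do not contain it. -/
theorem exists_isBasis_forall_inter_isBasis (M : Matroid α) {I₀ : Set α} (hI₀ : M.Indep I₀)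
    (C : Finset (Set α)) (X : Set α) (hX : X ⊆ M.E) (hCX : ∀ F ∈ C, F ⊆ X)
    (hC : IsChain (· ⊆ ·) (C : Set (Set α)))
    (hF : ∀ F ∈ C, I₀ ⊆ F ∨ ∀ J, M.IsBasis J F → M.Indep (J ∪ I₀)) :
    ∃ J, M.IsBasis J X ∧ (I₀ ⊆ X → I₀ ⊆ J) ∧ ∀ F ∈ C, M.IsBasis (J ∩ F) F := by
  classical
  induction hn : C.card generalizing C X with
  | zero =>
    obtain rfl := Finset.card_eq_zero.1 hn
    by_cases hIX : I₀ ⊆ X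
    · obtain ⟨J, hJ, hIJ⟩ := hI₀.subset_isBasis_of_subset hIX
      exact ⟨J, hJ, fun _ => hIJ, by simp⟩
    · obtain ⟨J, hJ⟩ := M.exists_isBasis X
      exact ⟨J, hJ, fun h => absurd h hIX, by simp⟩
  | succ n ih =>
    -- Peel off the largest member `F`. Extending a basis `J` of `F` cannot change its trace on `F`,
    -- so the smaller members stay compatible.
    obtain ⟨F, hFC, hFmax⟩ := C.exists_maximal (Finset.card_pos.1 (by omega))
    have hsub : ∀ G ∈ C, G ⊆ F := fun G hG =>
      (hC.total hG hFC).elim id fun h => hFmax hG h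
    obtain ⟨J, hJ, hIJ, hJC⟩ := ih (C.erase F) F ((hCX F hFC).trans hX)
      (fun G hG => hsub G (Finset.mem_of_mem_erase hG))
      (hC.mono (by simp))
      (fun G hG => hF G (Finset.mem_of_mem_erase hG)) (by simp [Finset.card_erase_of_mem hFC, hn])
    obtain ⟨J', hJ', hJJ', hIJ'⟩ : ∃ J', M.IsBasis J' X ∧ J ⊆ J' ∧ (I₀ ⊆ X → I₀ ⊆ J') := by
      by_cases hIX : I₀ ⊆ X
      · have hind : M.Indep (J ∪ I₀) := by
          rcases hF F hFC with h | h
          · rw [union_eq_self_of_subset_right (hIJ h)]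
            exact hJ.indep
          · exact h J hJ
        obtain ⟨J', hJ', hsub'⟩ := hind.subset_isBasis_of_subset
          (union_subset (hJ.subset.trans (hCX F hFC)) hIX)
        exact ⟨J', hJ', subset_union_left.trans hsub', fun _ => subset_union_right.trans hsub'⟩
      · obtain ⟨J', hJ', hsub'⟩ := hJ.indep.subset_isBasis_of_subset
          (hJ.subset.trans (hCX F hFC))
        exact ⟨J', hJ', hsub', fun h => absurd h hIX⟩
    have hJF : J' ∩ F = J := hJ.inter_eq_of_subset_indep hJJ' hJ'.indep
    refine ⟨J', hJ', hIJ', fun G hG => ?_⟩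
    by_cases hGF : G = F
    · rw [hGF, hJF]
      exact hJ
    · have := hJC G (Finset.mem_erase.2 ⟨hGF, hG⟩)
      rwa [← hJF, inter_assoc, inter_eq_self_of_subset_right (hsub G hG)] at this

open Classical in
/-- The weight of an element is the number of members of `C` that contain it. -/
noncomputable def chainWeight (C : Finset (Set α)) (e : α) : ℕ := (C.filter (e ∈ ·)).card

theorem setWeight_chainWeight {E : Finset α} (C : Finset (Set α)) {B : Set α}
    (hB : B ⊆ E) : setWeight E (chainWeight C) B = ∑ F ∈ C, (B ∩ F).ncard := by
  classical
  have h1 : ∀ F : Set α, (B ∩ F).ncard = ∑ e ∈ E, if e ∈ B ∩ F then 1 else 0 := by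
    intro F
    rw [← Finset.card_filter, ← Set.ncard_coe_finset]
    congr 1
    ext e
    simpa using fun he _ => hB he
  simp_rw [h1]
  rw [Finset.sum_comm, setWeight]
  refine Finset.sum_congr rfl fun e _ => ?_
  by_cases he : e ∈ B <;> simp [he, chainWeight]

/-- The weight of `B` is the sum of the `|B ∩ F|`, each at most the rank of `F`. Once some base
attains all these bounds, every maximal base must attain each of them. -/
theorem isMaxWeightBase_of_forall_isBasis {E : Finset α} {M : Matroid α} (hM : M.E = E)
    (C : Finset (Set α)) {B : Set α} (hB : M.IsBase B) (hBC : ∀ F ∈ C, M.IsBasis (B ∩ F) F) :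
    IsMaxWeightBase E (chainWeight C) M B ∧
      ∀ B', IsMaxWeightBase E (chainWeight C) M B' → ∀ F ∈ C, M.IsBasis (B' ∩ F) F := by
  have hfin : ∀ F : Set α, ∀ B, M.IsBase B → (B ∩ F).Finite := fun F B hB =>
    (E.finite_toSet.subset (hM ▸ hB.subset_ground)).subset inter_subset_left
  have hle : ∀ B', M.IsBase B' → ∀ F ∈ C, (B' ∩ F).ncard ≤ (B ∩ F).ncard := by
    intro B' hB' F hF
    rw [← Nat.cast_le (α := ℕ∞), (hfin F B' hB').cast_ncard_eq, (hfin F B hB).cast_ncard_eq,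
      (hBC F hF).encard_eq_eRk]
    exact (hB'.indep.subset inter_subset_left).encard_le_eRk_of_subset inter_subset_right
  have hw : ∀ B, M.IsBase B → setWeight E (chainWeight C) B = ∑ F ∈ C, (B ∩ F).ncard :=
    fun B hB => setWeight_chainWeight C (hM ▸ hB.subset_ground)
  refine ⟨⟨hB, fun B' hB' => ?_⟩, fun B' hB' F hF => ?_⟩
  · rw [hw B hB, hw B' hB']
    exact Finset.sum_le_sum (hle B' hB')
  · have hge := hB'.2 B hB
    rw [hw B hB, hw B' hB'.1] at hge
    have heq := (Finset.sum_eq_sum_iff_of_le (hle B' hB'.1)).1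
      (le_antisymm (Finset.sum_le_sum (hle B' hB'.1)) hge) F hF
    refine (Matroid.isBasis_iff_indep_encard_eq_of_finite (hfin F B' hB'.1)
      (hBC F hF).subset_ground).2 ⟨inter_subset_right, hB'.1.indep.subset inter_subset_left, ?_⟩
    rw [← (hBC F hF).encard_eq_eRk, ← (hfin F B hB).cast_ncard_eq,
      ← (hfin F B' hB'.1).cast_ncard_eq, heq]

/-- A matroid is loopless and has a given chain among its flats if and only if each element lies in
a base of maximal weight with respect to that chain. -/
theorem forall_mem_isMaxWeightBase_iff {E : Finset α} {M : Matroid α} (hM : M.E = E)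
    (C : Finset (Set α)) (hCE : ∀ F ∈ C, F ⊆ E) (hC : IsChain (· ⊆ ·) (C : Set (Set α))) :
    (∀ e ∈ E, ∃ B, IsMaxWeightBase E (chainWeight C) M B ∧ e ∈ B) ↔
      M.Loopless ∧ ∀ F ∈ C, M.IsFlat F := by
  have hgr : ∀ F ∈ C, F ⊆ M.E := fun F hF => hM ▸ hCE F hF
  constructor
  · obtain ⟨B₀, hB₀, -, hB₀C⟩ := exists_isBasis_forall_inter_isBasis M M.empty_indep C M.E
      subset_rfl hgr hC (fun F _ => Or.inl (empty_subset F))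
    have hmax := (isMaxWeightBase_of_forall_isBasis hM C (Matroid.isBasis_ground_iff.1 hB₀) hB₀C).2
    intro h
    refine ⟨Matroid.loopless_iff_forall_isNonloop.2 fun e he => ?_, fun F hF => ?_⟩
    · obtain ⟨B, hB, heB⟩ := h e (by simpa [hM] using he)
      exact hB.1.indep.isNonloop_of_mem heB
    · rw [Matroid.isFlat_iff_closure_eq]
      -- For `e` in the closure of `F`, take a maximal base `B` through `e`. Since `B ∩ F` spans `F`
      -- and `B` is independent, `e` lies in `B ∩ F`.
      refine subset_antisymm (fun e he => ?_) (M.subset_closure F (hgr F hF))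
      obtain ⟨B, hB, heB⟩ := h e (by simpa [hM] using M.mem_ground_of_mem_closure he)
      rw [← (hmax B hB F hF).closure_eq_closure] at he
      have := hB.1.indep.closure_inter_eq_self_of_subset (inter_subset_left (t := F))
      exact (this.subset ⟨he, heB⟩).2
  · rintro ⟨hl, hflat⟩ e he
    have heM : e ∈ M.E := by simpa [hM] using he
    have hnl := Matroid.loopless_iff_forall_isNonloop.1 hl e heM
    -- Start from `{e}`: if the flat `F` misses `e`, then `e` is outside the closure of any basis of
    -- `F` and can be added to it.
    obtain ⟨B, hB, heB, hBC⟩ := exists_isBasis_forall_inter_isBasis M hnl.indep C M.E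
      subset_rfl hgr hC fun F hF => by
        rw [singleton_subset_iff]
        refine or_iff_not_imp_left.2 fun heF J hJ => ?_
        rw [union_singleton, hJ.indep.insert_indep_iff_of_notMem fun h => heF (hJ.subset h),
          hJ.closure_eq_closure, (hflat F hF).closure]
        exact ⟨heM, heF⟩
    exact ⟨B, (isMaxWeightBase_of_forall_isBasis hM C (Matroid.isBasis_ground_iff.1 hB) hBC).1,
      by simpa [heM] using heB⟩

end Chain

/-! ### Counting chains of flats -/

section FlatChains

variable {α : Type*}

theorem isBot_flats_iff {M : Matroid α} (hl : M.Loopless) (F : Flats M) :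
    IsBot F ↔ F.1 = ∅ := by
  have h0 : M.IsFlat ∅ := by
    rw [Matroid.isFlat_iff_closure_eq]
    exact M.loops_eq_empty
  constructor
  · intro h
    exact subset_empty_iff.1 (h ⟨∅, h0⟩)
  · intro h G
    change F.1 ⊆ G.1
    simp [h]

theorem isTop_flats_iff {M : Matroid α} (F : Flats M) : IsTop F ↔ F.1 = M.E := by
  constructor
  · intro h
    exact subset_antisymm F.2.subset_ground (h ⟨M.E, M.ground_isFlat⟩)
  · intro h G
    change G.1 ⊆ F.1
    rw [h]
    exact G.2.subset_ground

theorem eq_of_isFlat_of_eRk_eq {M : Matroid α} [M.Finite] {F G : Set α} (hF : M.IsFlat F)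
    (hG : M.IsFlat G) (hFG : F ⊆ G) (h : M.eRk F = M.eRk G) : F = G := by
  rw [← hF.closure, ← hG.closure]
  exact (M.isRkFinite_set F).closure_eq_closure_of_subset_of_eRk_ge_eRk hFG h.ge

/-- Rank is injective on a chain of flats and lies strictly between `0` and the total rank on proper
ones. -/
theorem card_le_of_mem_orderComplex {M : Matroid α} [M.Finite] (hl : M.Loopless)
    {C : Finset (Flats M)} (hC : C ∈ orderComplex (Flats M)) :
    C.card ≤ M.eRank.toNat - 1 := by
  classical
  have hne : ∀ X, M.eRk X ≠ ⊤ := fun X => Matroid.eRk_ne_top_iff.2 (M.isRkFinite_set X)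
  have hinj : InjOn (fun F : Flats M => (M.eRk F.1).toNat) C := by
    intro F hF G hG hFG
    have heq : M.eRk F.1 = M.eRk G.1 := by
      rw [← ENat.natCast_toNat (hne F.1), ← ENat.natCast_toNat (hne G.1)]
      exact congrArg _ hFG
    rcases hC.1.total hF hG with h | h
    · exact Subtype.ext (eq_of_isFlat_of_eRk_eq F.2 G.2 h heq)
    · exact Subtype.ext (eq_of_isFlat_of_eRk_eq G.2 F.2 h heq.symm).symm
  rw [← Finset.card_image_of_injOn hinj]
  have hsub : C.image (fun F : Flats M => (M.eRk F.1).toNat) ⊆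
      Finset.Ico 1 M.eRank.toNat := by
    intro n hn
    obtain ⟨F, hF, rfl⟩ := Finset.mem_image.1 hn
    obtain ⟨hbot, htop⟩ := hC.2 F hF
    rw [isBot_flats_iff hl] at hbot
    rw [isTop_flats_iff] at htop
    rw [Finset.mem_Ico]
    constructor
    · rw [Nat.one_le_iff_ne_zero]
      intro h0
      have : M.eRk F.1 = 0 := by
        rw [← ENat.natCast_toNat (hne F.1), h0]; rfl
      rw [Matroid.eRk_eq_zero_iff F.2.subset_ground, M.loops_eq_empty] at this
      exact hbot (subset_empty_iff.1 this)
    · have hlt : M.eRk F.1 < M.eRank := by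
        refine lt_of_le_of_ne (M.eRk_le_eRank _) fun h => htop ?_
        rw [← M.eRk_ground] at h
        exact eq_of_isFlat_of_eRk_eq F.2 M.ground_isFlat F.2.subset_ground h
      rw [← M.eRk_ground] at hlt ⊢
      rw [← ENat.natCast_lt_natCast, ENat.natCast_toNat (hne _), ENat.natCast_toNat (hne _)]
      exact hlt
  simpa using Finset.card_le_card hsub

/-- The chain consists of closures of growing subsets of `I`, strictly increasing by independence.
-/
theorem exists_chain_flats {M : Matroid α} (I : Finset α) (hI : M.Indep I) :
    ∃ C : Finset (Flats M), IsChain (· ≤ ·) (C : Set (Flats M)) ∧ C.card = I.card ∧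
      ∀ F ∈ C, F.1.Nonempty ∧ F.1 ⊆ M.closure I := by
  classical
  induction I using Finset.induction_on with
  | empty => exact ⟨∅, by simp, rfl, by simp⟩
  | insert e I he ih =>
    rw [Finset.coe_insert] at hI ⊢
    obtain ⟨C, hC, hcard, hF⟩ := ih (hI.subset (subset_insert _ _))
    have hle : ∀ F ∈ C, F.1 ⊆ M.closure (insert e I) := fun F hFC =>
      (hF F hFC).2.trans (M.closure_subset_closure (subset_insert _ _))
    have heI : e ∉ M.closure (I : Set α) := by
      have := (hI.subset (subset_insert _ _)).insert_indep_iff_of_notMem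
        (Finset.mem_coe.not.2 he) |>.1 hI
      exact this.2
    have hecl : e ∈ M.closure (insert e I : Set α) :=
      M.subset_closure _ hI.subset_ground (mem_insert _ _)
    have hnot : (⟨M.closure (insert e I), M.isFlat_closure _⟩ : Flats M) ∉ C := fun hmem =>
      heI ((hF _ hmem).2 hecl)
    refine ⟨insert ⟨M.closure (insert e I), M.isFlat_closure _⟩ C, ?_, ?_, ?_⟩
    · rw [Finset.coe_insert]
      exact hC.insert fun F hFC _ => Or.inr (hle F hFC)
    · rw [Finset.card_insert_of_notMem hnot, Finset.card_insert_of_notMem he, hcard]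
    · intro F hFC
      rcases Finset.mem_insert.1 hFC with rfl | hFC
      · exact ⟨⟨e, hecl⟩, subset_rfl⟩
      · exact ⟨(hF F hFC).1, hle F hFC⟩

theorem exists_mem_orderComplex_card_eq {M : Matroid α} [M.Finite] (hl : M.Loopless)
    (hne : M.E.Nonempty) :
    1 ≤ M.eRank.toNat ∧ ∃ C ∈ orderComplex (Flats M), C.card = M.eRank.toNat - 1 := by
  classical
  obtain ⟨x, hx⟩ := hne
  obtain ⟨B, hB, hxB⟩ := (Matroid.loopless_iff_forall_isNonloop.1 hl x hx).exists_mem_isBase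
  have hBfin : B.Finite := M.set_finite B hB.subset_ground
  lift B to Finset α using hBfin
  have hr : M.eRank.toNat = B.card := by
    rw [← hB.encard_eq_eRank, encard_coe_eq_coe_finsetCard]; rfl
  rw [Finset.mem_coe] at hxB
  refine ⟨hr ▸ Finset.card_pos.2 ⟨x, hxB⟩, ?_⟩
  obtain ⟨C, hC, hcard, hF⟩ := exists_chain_flats (M := M) (B.erase x)
    (hB.indep.subset (by simp))
  refine ⟨C, ⟨hC, fun F hFC => ⟨?_, ?_⟩⟩, by rw [hcard, hr, Finset.card_erase_of_mem hxB]⟩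
  · rw [isBot_flats_iff hl]
    exact (hF F hFC).1.ne_empty
  · rw [isTop_flats_iff]
    intro h
    have h1 := (hF F hFC).2
    rw [h, Finset.coe_erase] at h1
    exact hB.indep.notMem_closure_sdiff_of_mem hxB (h1 hx)

theorem maxFaceSize_orderComplex_flats {M : Matroid α} [M.Finite] (hl : M.Loopless)
    (hne : M.E.Nonempty) : maxFaceSize (orderComplex (Flats M)) + 1 = M.eRank.toNat := by
  obtain ⟨h1, C, hC, hcard⟩ := exists_mem_orderComplex_card_eq hl hne
  have : IsGreatest (Finset.card '' orderComplex (Flats M)) (M.eRank.toNat - 1) := by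
    refine ⟨⟨C, hC, hcard⟩, ?_⟩
    rintro _ ⟨D, hD, rfl⟩
    exact card_le_of_mem_orderComplex hl hD
  rw [maxFaceSize, this.csSup_eq]
  omega

open Classical in
/-- The chains of non-empty proper subsets of `E`. -/
noncomputable def properChains (E : Finset α) : Finset (Finset (Set α)) :=
  (E.powerset.image fun A : Finset α => (A : Set α)).powerset.filter fun C =>
    IsChain (· ⊆ ·) (C : Set (Set α)) ∧ ∀ F ∈ C, F ≠ ∅ ∧ F ≠ E

theorem mem_properChains {E : Finset α} {C : Finset (Set α)} :
    C ∈ properChains E ↔ (∀ F ∈ C, F ⊆ E) ∧ IsChain (· ⊆ ·) (C : Set (Set α)) ∧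
      ∀ F ∈ C, F ≠ ∅ ∧ F ≠ E := by
  classical
  rw [properChains, Finset.mem_filter, Finset.mem_powerset]
  refine and_congr_left fun _ => forall₂_congr fun F _ => ?_
  rw [Finset.mem_image]
  constructor
  · rintro ⟨A, hA, rfl⟩
    exact_mod_cast Finset.mem_powerset.1 hA
  · intro hF
    lift F to Finset α using E.finite_toSet.subset hF
    exact ⟨F, Finset.mem_powerset.2 (by exact_mod_cast hF), rfl⟩

open Classical in
-- The index set now depends only on `E`, so relations can be tested one chain at a time.
theorem fVector_orderComplex_flats {E : Finset α} {M : Matroid α} (hM : M.E = E)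
    (hl : M.Loopless) (i : ℕ) :
    (fVector (orderComplex (Flats M)) i : ℤ) =
      ∑ C ∈ (properChains E).filter (·.card = i), if ∀ F ∈ C, M.IsFlat F then 1 else 0 := by
  rw [← Finset.sum_filter, Finset.sum_const, nsmul_one, fVector]
  congr 1
  rw [← ncard_coe_finset,
    ← ncard_image_of_injective _ (Finset.map_injective (Function.Embedding.subtype M.IsFlat))]
  congr 1
  ext C
  simp only [mem_image, mem_ofPred_eq, Finset.coe_filter, Finset.mem_filter, mem_properChains]
  constructor
  · rintro ⟨D, ⟨⟨hD, hDp⟩, rfl⟩, rfl⟩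
    refine ⟨⟨⟨?_, ?_, ?_⟩, Finset.card_map _⟩, ?_⟩
    · intro F hF
      obtain ⟨G, hG, rfl⟩ := Finset.mem_map.1 hF
      exact hM ▸ G.2.subset_ground
    · rw [Finset.coe_map]
      rintro _ ⟨F, hF, rfl⟩ _ ⟨G, hG, rfl⟩ -
      exact hD.total hF hG
    · intro F hF
      obtain ⟨G, hG, rfl⟩ := Finset.mem_map.1 hF
      have := hDp G hG
      rwa [isBot_flats_iff hl, isTop_flats_iff, hM] at this
    · intro F hF
      obtain ⟨G, hG, rfl⟩ := Finset.mem_map.1 hF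
      exact G.2
  · rintro ⟨⟨⟨-, hch, hp⟩, hcard⟩, hflat⟩
    refine ⟨C.subtype M.IsFlat, ⟨⟨?_, ?_⟩, ?_⟩, Finset.subtype_map_of_mem hflat⟩
    · intro F hF G hG hFG
      exact hch (Finset.mem_subtype.1 hF) (Finset.mem_subtype.1 hG) (Subtype.coe_injective.ne hFG)
    · intro F hF
      rw [isBot_flats_iff hl, isTop_flats_iff, hM]
      exact hp F.1 (Finset.mem_subtype.1 hF)
    · rw [Finset.card_subtype, Finset.filter_true_of_mem hflat, hcard]

open Classical in
-- With loops the covering condition fails for every chain, so one formula includes the zero case.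
theorem chainPolynomial_eq_sum {E : Finset α} (hE : E.Nonempty) (M : FinMatroid α)
    (hM : M.1.E = E) :
    chainPolynomial M = ∑ i ∈ Finset.range M.1.eRank.toNat,
      C (∑ D ∈ (properChains E).filter (·.card = i),
        if ∀ e ∈ E, ∃ B, IsMaxWeightBase E (chainWeight D) M.1 B ∧ e ∈ B then (1 : ℤ) else 0) *
      X ^ (M.1.eRank.toNat - 1 - i) := by
  have := M.2
  have hne : M.1.E.Nonempty := hM ▸ hE
  have hiff : ∀ D ∈ properChains E,
      ((∀ e ∈ E, ∃ B, IsMaxWeightBase E (chainWeight D) M.1 B ∧ e ∈ B) ↔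
        M.1.Loopless ∧ ∀ F ∈ D, M.1.IsFlat F) := fun D hD => by
    rw [mem_properChains] at hD
    exact forall_mem_isMaxWeightBase_iff hM D hD.1 hD.2.1
  by_cases hl : M.1.Loopless
  · rw [chainPolynomial, if_pos ⟨hl, hne⟩, fPolynomial, maxFaceSize_orderComplex_flats hl hne,
      ← maxFaceSize_orderComplex_flats hl hne, Nat.add_sub_cancel]
    refine Finset.sum_congr rfl fun i _ => ?_
    rw [fVector_orderComplex_flats hM hl]
    congr 2
    refine Finset.sum_congr rfl fun D hD => ?_
    rw [if_congr (hiff D (Finset.mem_filter.1 hD).1) rfl rfl]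
    simp [hl]
  · rw [chainPolynomial, if_neg fun h => hl h.1]
    refine (Finset.sum_eq_zero fun i _ => ?_).symm
    rw [Finset.sum_eq_zero fun D hD => ?_, C_0, zero_mul]
    rw [if_congr (hiff D (Finset.mem_filter.1 hD).1) rfl rfl, if_neg fun h => hl h.1]

end FlatChains

/-! ### Splitting relations by rank -/

section Relations

variable {α : Type*}

theorem weightFunctional_one_of_mem_basePolytope {E : Finset α} {M : Matroid α} (hM : M.E = E)
    {x : E → ℝ} (hx : x ∈ basePolytope E M) :
    weightFunctional E 1 x = (M.eRank.toNat : ℝ) := by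
  classical
  have hsub : basePolytope E M ⊆ weightFunctional E 1 ⁻¹' {(M.eRank.toNat : ℝ)} := by
    refine convexHull_min ?_ ((convex_singleton _).linear_preimage _)
    rintro _ ⟨B, hB, rfl⟩
    have hBE : B ⊆ E := hM ▸ hB.subset_ground
    lift B to Finset α using E.finite_toSet.subset hBE
    rw [mem_preimage, weightFunctional_indicator, mem_singleton_iff, ← hB.encard_eq_eRank,
      encard_coe_eq_coe_finsetCard, ENat.toNat_natCast, Nat.cast_inj, setWeight,
      Finset.sum_congr rfl fun e _ => Set.indicator_apply _ _ e, ← Finset.sum_filter]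
    simp only [Pi.one_apply, Finset.sum_const, smul_eq_mul, mul_one, Finset.mem_coe]
    congr 1
    ext e
    simpa using fun he => hBE he
  exact hsub hx

/-- The part of a linear relation between base polytopes that concerns matroids of a fixed rank. -/
theorem sum_ite_eRank_eq_zero {ι : Type*} (E : Finset α) (s : Finset ι) (a : ι → ℤ)
    (M : ι → Matroid α) (hM : ∀ i, (M i).E = E)
    (h : ∀ x, ∑ i ∈ s, a i * indicatorFun (basePolytope E (M i)) x = 0) (r : ℕ) (x : E → ℝ) :
    ∑ i ∈ s, (if (M i).eRank.toNat = r then a i else 0) *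
      indicatorFun (basePolytope E (M i)) x = 0 := by
  by_cases hx : weightFunctional E 1 x = r
  · rw [← h x]
    refine Finset.sum_congr rfl fun i _ => ?_
    by_cases hi : x ∈ basePolytope E (M i)
    · have := weightFunctional_one_of_mem_basePolytope (hM i) hi
      rw [hx, Nat.cast_inj] at this
      rw [if_pos this.symm]
    · simp [indicatorFun, hi]
  · refine Finset.sum_eq_zero fun i _ => ?_
    by_cases hi : x ∈ basePolytope E (M i)
    · have := weightFunctional_one_of_mem_basePolytope (hM i) hi
      rw [if_neg, zero_mul]
      rintro rfl
      exact hx this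
    · simp [indicatorFun, hi]

/-- The chain polynomial respects linear relations between base polytopes. -/
theorem sum_smul_chainPolynomial_eq_zero {ι : Type*} (E : Finset α) (s : Finset ι) (a : ι → ℤ)
    (M : ι → FinMatroid α) (hM : ∀ i, (M i).1.E = E)
    (h : ∀ x, ∑ i ∈ s, a i * indicatorFun (basePolytope E (M i).1) x = 0) :
    ∑ i ∈ s, a i • chainPolynomial (M i) = 0 := by
  classical
  rcases E.eq_empty_or_nonempty with rfl | hE
  · refine Finset.sum_eq_zero fun i _ => ?_
    rw [chainPolynomial, if_neg, smul_zero]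
    rintro ⟨-, hne⟩
    simp [hM i] at hne
  -- Here the rank is a free parameter `r`; for fixed `r`, the exponents no longer depend on the
  -- matroid.
  set g : ℕ → ι → ℤ[X] := fun r j => ∑ i ∈ Finset.range r,
      C (∑ D ∈ (properChains E).filter (·.card = i),
        if ∀ e ∈ E, ∃ B, IsMaxWeightBase E (chainWeight D) (M j).1 B ∧ e ∈ B
          then (1 : ℤ) else 0) * X ^ (r - 1 - i) with hg
  have hr : ∀ j ∈ s, a j • chainPolynomial (M j) =
      ∑ r ∈ s.image fun j => (M j).1.eRank.toNat,
        (if (M j).1.eRank.toNat = r then a j else 0) • g r j := by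
    intro j hj
    rw [chainPolynomial_eq_sum hE (M j) (hM j)]
    simp only [ite_smul, zero_smul]
    rw [Finset.sum_ite_eq, if_pos (Finset.mem_image_of_mem _ hj)]
  rw [Finset.sum_congr rfl hr, Finset.sum_comm]
  refine Finset.sum_eq_zero fun r _ => ?_
  simp only [hg, Finset.smul_sum]
  rw [Finset.sum_comm]
  refine Finset.sum_eq_zero fun i _ => ?_
  simp only [← smul_mul_assoc, ← Finset.sum_mul, smul_C, ← map_sum, Finset.smul_sum]
  rw [Finset.sum_comm, Finset.sum_eq_zero fun D _ => ?_, C_0, zero_mul]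
  exact sum_forall_mem_isMaxWeightBase_eq_zero E s _ (fun j => (M j).1)
    (sum_ite_eRank_eq_zero E s a _ hM h r) (chainWeight D)

end Relations

/-- On the free abelian group on `ι`, the hypothesis puts the kernel of the map to indicators inside
the kernel of the map to `A`, so the latter factors through the former's range. Hence `f i` depends
only on `P i`. -/
theorem isStrongValuation_of_relations {ι V A : Type*} [AddCommGroup A] (P : ι → Set V)
    (f : ι → A) {𝔓 : Set (Set V)} (h𝔓 : range P = 𝔓) (h : ∀ (s : Finset ι) (a : ι → ℤ),
      (∀ x, ∑ i ∈ s, a i * indicatorFun (P i) x = 0) → ∑ i ∈ s, a i • f i = 0) :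
    ∃ F : 𝔓 → A, IsStrongValuation 𝔓 F ∧ ∀ i, F ⟨P i, h𝔓 ▸ mem_range_self i⟩ = f i := by
  subst h𝔓
  set φ : (ι →₀ ℤ) →ₗ[ℤ] (V → ℤ) := Finsupp.linearCombination ℤ fun i => indicatorFun (P i)
  set ψ : (ι →₀ ℤ) →ₗ[ℤ] A := Finsupp.linearCombination ℤ f
  have hker : LinearMap.ker φ ≤ LinearMap.ker ψ := by
    intro a ha
    rw [LinearMap.mem_ker] at ha ⊢
    refine h a.support a fun x => ?_
    have := congrFun ha x
    simpa [φ, Finsupp.linearCombination_apply, Finsupp.sum] using this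
  have hmem : ∀ y : indicatorSubgroup (range P), (y : V → ℤ) ∈ LinearMap.range φ := by
    intro y
    have : indicatorSubgroup (range P) ≤ (LinearMap.range φ).toAddSubgroup := by
      rw [indicatorSubgroup, AddSubgroup.closure_le]
      rintro _ ⟨_, ⟨i, rfl⟩, rfl⟩
      exact ⟨Finsupp.single i 1, by simp [φ]⟩
    exact this y.2
  set g : LinearMap.range φ →ₗ[ℤ] A :=
    ((LinearMap.ker φ).liftQ ψ hker).comp φ.quotKerEquivRange.symm.toLinearMap
  have hg : ∀ a (ha : φ a ∈ LinearMap.range φ), g ⟨φ a, ha⟩ = ψ a := by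
    intro a ha
    have : φ.quotKerEquivRange.symm ⟨φ a, ha⟩ = (LinearMap.ker φ).mkQ a := by
      rw [LinearEquiv.symm_apply_eq]
      rfl
    simp [g, this]
  set G : indicatorSubgroup (range P) →+ A := g.toAddMonoidHom.comp
    { toFun := fun y => ⟨y, hmem y⟩, map_zero' := rfl, map_add' := fun _ _ => rfl }
  refine ⟨fun Q => G ⟨indicatorFun Q.1, AddSubgroup.subset_closure (mem_image_of_mem _ Q.2)⟩,
    ⟨G, fun _ => rfl⟩, fun i => ?_⟩
  have h1 : φ (Finsupp.single i 1) = indicatorFun (P i) := by simp [φ]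
  have h2 : ψ (Finsupp.single i 1) = f i := by simp [ψ]
  rw [← h2, ← hg _ (LinearMap.mem_range_self φ _)]
  change g _ = g _
  congr 1
  exact Subtype.ext h1.symm

theorem isValuation_chainPolynomial (α : Type*) :
    IsValuation (chainPolynomial : FinMatroid α → ℤ[X]) := by
  intro E
  have hfin : ∀ M : Matroid α, M.E = E → M.Finite := fun M hM => ⟨hM ▸ E.finite_toSet⟩
  set ι := {M : Matroid α // M.E = (E : Set α)}
  have hrange : range (fun M : ι => basePolytope E M.1) = basePolytopes E := by
    ext P
    constructor
    · rintro ⟨M, rfl⟩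
      exact ⟨M.1, M.2, rfl⟩
    · rintro ⟨M, hM, rfl⟩
      exact ⟨⟨M, hM⟩, rfl⟩
  obtain ⟨F, hF, hFM⟩ := isStrongValuation_of_relations (ι := ι) (fun M => basePolytope E M.1)
    (fun M => chainPolynomial ⟨M.1, hfin M.1 M.2⟩) hrange
    (fun s a h => sum_smul_chainPolynomial_eq_zero E s a
      (fun M : ι => ⟨M.1, hfin M.1 M.2⟩) (fun M => M.2) h)
  exact ⟨F, hF, fun M hM => hFM ⟨M.1, hM⟩⟩

/-! ### Invariance under isomorphism -/

section Invariance

theorem fPolynomial_image_map {V W : Type*} (Δ : Set (Finset V)) (e : V ↪ W) :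
    fPolynomial (Finset.map e '' Δ) = fPolynomial Δ := by
  have hmax : maxFaceSize (Finset.map e '' Δ) = maxFaceSize Δ := by
    rw [maxFaceSize, image_image]
    simp only [Finset.card_map]
    rfl
  have hvec : ∀ i, fVector (Finset.map e '' Δ) i = fVector Δ i := by
    intro i
    rw [fVector, fVector, ← ncard_image_of_injective _ (Finset.map_injective e)]
    congr 1
    ext C
    constructor
    · rintro ⟨⟨D, hD, rfl⟩, hC⟩
      exact ⟨D, ⟨hD, by simpa using hC⟩, rfl⟩
    · rintro ⟨D, ⟨hD, hC⟩, rfl⟩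
      exact ⟨⟨D, hD, rfl⟩, by simpa using hC⟩
  simp only [fPolynomial, hmax, hvec]

theorem map_mem_orderComplex {P Q : Type*} [PartialOrder P] [PartialOrder Q] (e : P ≃o Q)
    {C : Finset P} (hC : C ∈ orderComplex P) :
    C.map e.toEquiv.toEmbedding ∈ orderComplex Q := by
  refine ⟨?_, fun y hy => ?_⟩
  · rw [Finset.coe_map]
    rintro _ ⟨x, hx, rfl⟩ _ ⟨y, hy, rfl⟩ -
    exact (hC.1.total hx hy).imp (e.monotone ·) (e.monotone ·)
  · obtain ⟨x, hx, rfl⟩ := Finset.mem_map.1 hy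
    exact ⟨fun h => (hC.2 x hx).1 fun z => e.le_iff_le.1 (h (e z)),
      fun h => (hC.2 x hx).2 fun z => e.le_iff_le.1 (h (e z))⟩

theorem orderComplex_orderIso {P Q : Type*} [PartialOrder P] [PartialOrder Q] (e : P ≃o Q) :
    orderComplex Q = Finset.map e.toEquiv.toEmbedding '' orderComplex P := by
  ext C
  constructor
  · intro hC
    refine ⟨_, map_mem_orderComplex e.symm hC, ?_⟩
    ext x
    simp
  · rintro ⟨D, hD, rfl⟩
    exact map_mem_orderComplex e hD

/-- The bijection of ground sets is extended by an arbitrary value outside `M.E`, reducing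
isomorphism to `Matroid.map`. -/
theorem exists_map_eq_of_isomorphic {α β : Type*} [Nonempty β] {M : Matroid α} {N : Matroid β}
    (h : Isomorphic M N) : ∃ (f : α → β) (hf : InjOn f M.E), N = M.map f hf := by
  classical
  obtain ⟨e, he⟩ := h
  set f : α → β := fun a => if h : a ∈ M.E then e ⟨a, h⟩ else Classical.arbitrary β with hf
  have hfe : ∀ a : M.E, f a = e a := fun a => by simp [hf]
  have hinj : InjOn f M.E := by
    intro a ha b hb hab
    have := hfe ⟨a, ha⟩ ▸ hfe ⟨b, hb⟩ ▸ hab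
    exact congrArg Subtype.val (e.injective (Subtype.ext this))
  have himg : ∀ B : Set M.E, f '' (Subtype.val '' B) = Subtype.val '' (e '' B) := fun B => by
    simp only [image_image, hfe]
  refine ⟨f, hinj, Matroid.ext_isBase ?_ fun B hB => ?_⟩
  · have := himg univ
    simpa using this.symm
  · rw [Matroid.map_isBase_iff]
    constructor
    · intro hNB
      refine ⟨Subtype.val '' (e.symm '' (Subtype.val ⁻¹' B)), ?_, ?_⟩
      · rw [he, e.image_symm_image, Subtype.image_preimage_coe, inter_eq_self_of_subset_right hB]
        exact hNB
      · rw [himg, e.image_symm_image, Subtype.image_preimage_coe,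
          inter_eq_self_of_subset_right hB]
    · rintro ⟨B, hMB, rfl⟩
      have hBE : Subtype.val '' (Subtype.val ⁻¹' B : Set M.E) = B := by
        rw [Subtype.image_preimage_coe, inter_eq_self_of_subset_right hMB.subset_ground]
      rw [← hBE] at hMB ⊢
      rw [himg]
      exact (he _).1 hMB

variable {α β : Type*}

theorem isFlat_map_image {M : Matroid α} {f : α → β} (hf : InjOn f M.E) {F : Set α}
    (hF : M.IsFlat F) : (M.map f hf).IsFlat (f '' F) := by
  rw [Matroid.isFlat_iff_closure_eq, Matroid.map_closure_eq, ← M.closure_inter_ground,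
    hf.preimage_image_inter hF.subset_ground, hF.closure]

theorem exists_isFlat_image_eq {M : Matroid α} {f : α → β} (hf : InjOn f M.E) {G : Set β}
    (hG : (M.map f hf).IsFlat G) : ∃ F, M.IsFlat F ∧ f '' F = G :=
  ⟨M.closure (f ⁻¹' G), M.isFlat_closure _, by rw [← Matroid.map_closure_eq M f hf, hG.closure]⟩

/-- The image of a matroid under an injection has an isomorphic lattice of flats. -/
noncomputable def flatsMap (M : Matroid α) (f : α → β) (hf : InjOn f M.E) :
    Flats M ≃o Flats (M.map f hf) :=
  RelIso.ofSurjective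
    (OrderEmbedding.ofMapLEIff (fun F : Flats M =>
      (⟨f '' F.1, isFlat_map_image hf F.2⟩ : Flats (M.map f hf)))
      fun F G => hf.image_subset_image_iff F.2.subset_ground G.2.subset_ground)
    fun G => by
      obtain ⟨F, hF, hFG⟩ := exists_isFlat_image_eq hf G.2
      exact ⟨⟨F, hF⟩, Subtype.ext hFG⟩

theorem map_loopless_iff (M : Matroid α) (f : α → β) (hf : InjOn f M.E) :
    (M.map f hf).Loopless ↔ M.Loopless := by
  rw [Matroid.loopless_iff, Matroid.loopless_iff, Matroid.loops, Matroid.loops,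
    Matroid.map_closure_eq, preimage_empty, image_eq_empty]

theorem isInvariant_chainPolynomial (α : Type*) :
    IsInvariant (chainPolynomial : FinMatroid α → ℤ[X]) := by
  rintro ⟨M, hM⟩ ⟨N, hN⟩ h
  -- With `α` empty there is no value to extend by, but all ground sets are empty and both
  -- polynomials vanish.
  rcases isEmpty_or_nonempty α with hα | hα
  · simp [chainPolynomial, Set.eq_empty_of_isEmpty]
  obtain ⟨f, hf, rfl⟩ := exists_map_eq_of_isomorphic h
  classical
  exact if_congr (and_congr (map_loopless_iff M f hf).symm image_nonempty.symm)
    (by rw [orderComplex_orderIso (flatsMap M f hf), fPolynomial_image_map]) rfl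

end Invariance

end ChainPoly

theorem theorem7p9 (α : Type*) :
    ChainPoly.IsValuativeInvariant
      (ChainPoly.chainPolynomial : ChainPoly.FinMatroid α → Polynomial ℤ) := by
  exact ⟨ChainPoly.isInvariant_chainPolynomial α, ChainPoly.isValuation_chainPolynomial α⟩
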